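/- Digraphs are finite, labelled by $\{1,\dots,n\}$ for some $n\ge 0$, without loops or multiple edges (both $x\to y$ and $y\to x$ may be present); the empty digraph is not strongly connected. A family of digraphs is any set $\mathcal A$ of such digraphs. Write $a_n(w)=\sum_{G} w^{e(G)}$, the sum being over the $G\in\mathcal A$ with $n$ vertices, where $e(G)$ is the number of directed edges. The exponential generating function (EGF) and the graphic generating function (GGF) of $\mathcal A$ are the formal power series $$A(z,w)=\sum_{n\ge0}a_n(w)\frac{z^n}{n!},\qquad \mathbf A(z,w)=\sum_{n\ge0}\frac{a_n(w)}{(1+w)^{\binom n2}}\frac{z^n}{n!}$$ in $z$ with coefficients in $\mathbb Q[u][[w]]$. If a variable $u$ marks a parameter $\chi$, then $a_n(w)$ is replaced by $\sum_G w^{e(G)}u^{\chi(G)}$. The exponential Hadamard product with respect to $z$ is $\left(\sum_n a_n\frac{z^n}{n!}\right)\odot\left(\sum_n b_n\frac{z^n}{n!}\right)=\sum_n a_nb_n\frac{z^n}{n!}$. Let $\mathbf{Set}(z,w)$ be the GGF of the digraphs without edges, and $SCC(z,w)$ the EGF of all strongly connected digraphs. **Corollary 3.6.** Let $\mathcal B$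 be a nonempty family of strongly connected digraphs, with EGF $B(z,w)$. A strongly connected component of a digraph is said to belong to $\mathcal B$ if the subdigraph it induces, relabelled by $\{1,\dots,k\}$ in the order-preserving way ($k$ being its number of vertices), is a member of $\mathcal B$; if $\mathcal B$ is closed under isomorphism, this means that it is isomorphic to a member of $\mathcal B$. Then $(1-u)B(z,w)-SCC(z,w)$ has no constant term in $z$, the series $\mathbf{Set}(z,w)\odot e^{(1-u)B(z,w)-SCC(z,w)}$ is invertible, and the GGF of all digraphs, with $u$ marking the number of strongly connected components belonging to $\mathcal B$, is $$\frac{1}{\mathbf{Set}(z,w)\odot e^{(1-u)B(z,w)-SCC(z,w)}}.$$ -/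

import Mathlib

open scoped Nat

noncomputable section

namespace DigraphGF

/-- Labelled digraphs on the `n` labels `Fin n`, without loops or multiple edges
(both `u → v` and `v → u` may be present). -/
abbrev LDigraph (n : ℕ) : Type := {G : Digraph (Fin n) // ∀ v, ¬ G.Adj v v}

instance (n : ℕ) : Fintype (LDigraph n) := Fintype.ofFinite _

/-- A family of labelled digraphs: any set of labelled digraphs, of arbitrary orders. -/
abbrev Family : Type := Set (Σ n : ℕ, LDigraph n)

variable {n : ℕ}

/-- The number of directed edges. -/
def LDigraph.numEdges (G : LDigraph n) : ℕ :=
  {p : Fin n × Fin n | G.1.Adj p.1 p.2}.ncard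

/-- `v` can be reached from `u` by a (possibly empty) directed path. -/
def LDigraph.Reach (G : LDigraph n) (u v : Fin n) : Prop :=
  Relation.ReflTransGen G.1.Adj u v

/-- Strong connectivity; the empty digraph is not strongly connected. -/
def LDigraph.IsStronglyConnected (G : LDigraph n) : Prop :=
  0 < n ∧ ∀ u v, G.Reach u v

/-- `S` is (the vertex set of) a strongly connected component of `G`: a class of the relation
"each of the two vertices can be reached from the other". -/
def LDigraph.IsComponent (G : LDigraph n) (S : Finset (Fin n)) : Prop :=
  ∃ v, ∀ u, u ∈ S ↔ G.Reach v u ∧ G.Reach u v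

/-- The subdigraph of `G` induced by `S`, relabelled by `Fin S.card` in the unique way that
preserves the order of the labels. -/
def LDigraph.relabelledInduce (G : LDigraph n) (S : Finset (Fin n)) : LDigraph S.card :=
  ⟨{ Adj := fun i j => G.1.Adj (S.orderEmbOfFin rfl i) (S.orderEmbOfFin rfl j) },
    fun i => G.2 (S.orderEmbOfFin rfl i)⟩

/-- The number of strongly connected components of `G` that belong to the family `B`. -/
def numComponentsIn (B : Family) (G : LDigraph n) : ℕ :=
  {S : Finset (Fin n) | G.IsComponent S ∧ ⟨S.card, G.relabelledInduce S⟩ ∈ B}.ncard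

/-- The family of all digraphs. -/
def allDigraphs : Family := Set.univ

/-- The family of all strongly connected digraphs. -/
def stronglyConnected : Family := {G | G.2.IsStronglyConnected}

/-- The family of (labelled) sets: digraphs without edges. -/
def edgeless : Family := {G | ∀ u v, ¬ G.2.1.Adj u v}

/-- The ring of coefficients `ℚ[u]⟦w⟧`. -/
abbrev Coeff : Type := PowerSeries (Polynomial ℚ)

/-- The variable `w`, which marks edges. -/
def w : Coeff := PowerSeries.X

/-- The variable `u`, which marks an additional parameter. -/
def u : Coeff := PowerSeries.C Polynomial.X

/-- The series `1 + w` is invertible in `ℚ[u]⟦w⟧`. -/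
theorem isUnit_one_add_w : IsUnit (1 + w) := by
  rw [PowerSeries.isUnit_iff_constantCoeff]
  simp [w]

open Classical in
/-- The sequence `aₙ(w, u)` of a family `A` whose parameter `χ` is marked by `u`: the coefficient
of `w ^ m * u ^ p` in `aₙ` is the number of members of `A` with `n` vertices, `m` edges and
parameter equal to `p`. -/
def countSeq (A : Family) (χ : ∀ n, LDigraph n → ℕ) (n : ℕ) : Coeff :=
  ∑ G : LDigraph n with (⟨n, G⟩ : Σ n, LDigraph n) ∈ A, w ^ G.numEdges * u ^ χ n G

/-- The exponential generating function `∑ aₙ zⁿ / n!` of a sequence, as a series in `z`. -/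
def egf (a : ℕ → Coeff) : PowerSeries Coeff :=
  PowerSeries.mk fun n => (1 / (n ! : ℚ)) • a n

/-- The graphic generating function `∑ aₙ / (1 + w) ^ (n choose 2) * zⁿ / n!` of a sequence,
as a series in `z`. -/
def ggf (a : ℕ → Coeff) : PowerSeries Coeff :=
  PowerSeries.mk fun n => (1 / (n ! : ℚ)) • (a n * Ring.inverse ((1 + w) ^ n.choose 2))

/-- The EGF of a family, with no additional parameter. -/
def familyEGF (A : Family) : PowerSeries Coeff := egf (countSeq A fun _ _ => 0)

/-- The GGF of a family, with no additional parameter. -/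
def familyGGF (A : Family) : PowerSeries Coeff := ggf (countSeq A fun _ _ => 0)

/-- The GGF of a family `A` in which `u` marks the parameter `χ`. -/
def markedGGF (A : Family) (χ : ∀ n, LDigraph n → ℕ) : PowerSeries Coeff := ggf (countSeq A χ)

/-- The exponential Hadamard product with respect to `z`:
`(∑ aₙ zⁿ / n!) ⊙ (∑ bₙ zⁿ / n!) = ∑ aₙ bₙ zⁿ / n!`. -/
def expHadamard (A B : PowerSeries Coeff) : PowerSeries Coeff :=
  PowerSeries.mk fun n =>
    (1 / (n ! : ℚ)) • (((n ! : ℚ) • PowerSeries.coeff n A) * ((n ! : ℚ) • PowerSeries.coeff n B))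

/-- `e ^ F` for a series `F` in `z` without constant term, by substitution of `F` into the
exponential series. -/
def expOf (F : PowerSeries Coeff) : PowerSeries Coeff :=
  (PowerSeries.exp ℚ).subst F

end DigraphGF

end

/-! Call a digraph balanced if it is a disjoint union of strongly connected digraphs, and let
`sumBalanced` count these with sign `(-1)` to the number of components, with `w` on edges and `u` on
components in `B`. Two identities carry the proof.

The exponential formula: a strongly connected digraph is its own only component, so the exponent is
minus the EGF of strongly connected digraphs with `u` marking membership in `B` (`countSeq_strong`).
Hence its exponential is the EGF of `sumBalanced`: the component of a distinguished vertex gives the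
recurrence (`sumBalanced_insert`), and the equation `(e^F)' = F' e^F` gives the same one
(`coeff_expOf_egf`). The Hadamard product with `Set` turns this EGF into a GGF.

Inclusion-exclusion: the product of that GGF with the GGF of all digraphs counts digraphs with a
chosen set of source components (those with no incoming edges), signed by the size of the choice.
The `(1+w)` powers in the GGFs account for the free edges from the chosen vertices `U` to the rest.
Every nonempty digraph has a source component, and toggling it cancels all terms
(`sum_sign_isSourceUnion`). So the product is 1. -/

noncomputable section

namespace DigraphGF

/-! ### Digraphs as edge sets on a finite vertex set -/

section EdgeSets

set_option linter.unusedSectionVars false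

open Classical Finset

variable {α β : Type*} [LinearOrder α] [LinearOrder β]

/-- Reachability along the directed edges in `E`. -/
def Reaches (E : Finset (α × α)) : α → α → Prop :=
  Relation.ReflTransGen fun a b => (a, b) ∈ E

theorem Reaches.mono {E E' : Finset (α × α)} (h : E ⊆ E') {a b : α} (hab : Reaches E a b) :
    Reaches E' a b :=
  Relation.ReflTransGen.mono (fun _ _ hE => h hE) _ _ hab

/-- The strongly connected component of `v` in the digraph on `S` with edge set `E`. -/
def scc (S : Finset α) (E : Finset (α × α)) (v : α) : Finset α :=
  S.filter fun x => Reaches E v x ∧ Reaches E x v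

theorem mem_scc {S : Finset α} {E : Finset (α × α)} {v x : α} :
    x ∈ scc S E v ↔ x ∈ S ∧ Reaches E v x ∧ Reaches E x v := by
  simp [scc]

theorem self_mem_scc {S : Finset α} {E : Finset (α × α)} {v : α} (hv : v ∈ S) :
    v ∈ scc S E v :=
  mem_scc.2 ⟨hv, .refl, .refl⟩

theorem scc_subset (S : Finset α) (E : Finset (α × α)) (v : α) : scc S E v ⊆ S :=
  filter_subset _ _

theorem scc_eq_of_mem {S : Finset α} {E : Finset (α × α)} {v x : α} (hx : x ∈ scc S E v) :
    scc S E x = scc S E v := by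
  obtain ⟨-, h1, h2⟩ := mem_scc.1 hx
  ext y
  simp only [mem_scc]
  exact ⟨fun ⟨hy, h3, h4⟩ => ⟨hy, h1.trans h3, h4.trans h2⟩,
    fun ⟨hy, h3, h4⟩ => ⟨hy, h2.trans h3, h4.trans h1⟩⟩

/-- The set of strongly connected components. -/
def comps (S : Finset α) (E : Finset (α × α)) : Finset (Finset α) :=
  S.image (scc S E)

theorem subset_of_mem_comps {S C : Finset α} {E : Finset (α × α)} (h : C ∈ comps S E) : C ⊆ S := by
  obtain ⟨v, -, rfl⟩ := mem_image.1 h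
  exact scc_subset _ _ _

theorem nonempty_of_mem_comps {S C : Finset α} {E : Finset (α × α)} (h : C ∈ comps S E) :
    C.Nonempty := by
  obtain ⟨v, hv, rfl⟩ := mem_image.1 h
  exact ⟨v, self_mem_scc hv⟩

theorem disjoint_comps {U T : Finset α} (h : Disjoint U T) (E E' : Finset (α × α)) :
    Disjoint (comps U E) (comps T E') := by
  rw [disjoint_left]
  intro C h1 h2
  obtain ⟨x, hx⟩ := nonempty_of_mem_comps h1
  exact disjoint_left.1 h (subset_of_mem_comps h1 hx) (subset_of_mem_comps h2 hx)

/-- The subdigraph that `E` induces on `C` is an order-preserving copy of a member of `B`. -/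
def Belongs (B : Family) (C : Finset α) (E : Finset (α × α)) : Prop :=
  ∃ H ∈ B, ∃ f : Fin H.1 ↪o α, univ.map f.toEmbedding = C ∧
    ∀ i j, H.2.1.Adj i j ↔ (f i, f j) ∈ E

theorem belongs_congr {B : Family} {C : Finset α} {E E' : Finset (α × α)}
    (h : ∀ a ∈ C, ∀ b ∈ C, (a, b) ∈ E ↔ (a, b) ∈ E') : Belongs B C E ↔ Belongs B C E' := by
  unfold Belongs
  refine exists_congr fun H => and_congr_right fun _ => exists_congr fun f =>
    and_congr_right fun hf => forall_congr' fun i => forall_congr' fun j => ?_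
  rw [h _ (by simp [← hf]) _ (by simp [← hf])]

/-- The image of an edge set under a map of the vertices. -/
abbrev mapEdges (f : α ↪o β) (E : Finset (α × α)) : Finset (β × β) :=
  E.map (f.toEmbedding.prodMap f.toEmbedding)

theorem mk_mem_mapEdges {f : α ↪o β} {E : Finset (α × α)} {a b : α} :
    (f a, f b) ∈ mapEdges f E ↔ (a, b) ∈ E := by
  simp [mapEdges]

/-- `B` need not be closed under isomorphism, so transport is along order embeddings only: these
preserve the order-preserving relabelling. -/
theorem belongs_map {B : Family} {C : Finset α} {E : Finset (α × α)} (f : α ↪o β) :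
    Belongs B (C.map f.toEmbedding) (mapEdges f E) ↔ Belongs B C E := by
  constructor
  · rintro ⟨H, hH, g, hg, hadj⟩
    have hex : ∀ i, ∃ a ∈ C, f a = g i := fun i => by
      have : g i ∈ C.map f.toEmbedding := by simp [← hg]
      simpa using this
    choose k hkC hk using hex
    have hmono : StrictMono k := fun i j hij => by
      rw [← f.lt_iff_lt, hk, hk]
      exact g.lt_iff_lt.2 hij
    refine ⟨H, hH, OrderEmbedding.ofStrictMono k hmono, ?_, fun i j => ?_⟩
    · apply map_injective f.toEmbedding
      rw [← hg, map_map]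
      congr 1
      ext i
      simp [hk]
    · rw [hadj, ← hk, ← hk, mk_mem_mapEdges]
      simp
  · rintro ⟨H, hH, g, rfl, hadj⟩
    refine ⟨H, hH, g.trans f, ?_, fun i j => ?_⟩
    · rw [map_map]; rfl
    · rw [hadj, RelEmbedding.trans_apply, RelEmbedding.trans_apply, mk_mem_mapEdges]

theorem reaches_map {E : Finset (α × α)} (f : α ↪o β) {a b : α} :
    Reaches (mapEdges f E) (f a) (f b) ↔ Reaches E a b := by
  constructor
  · intro h
    -- A path that starts in the image of `f` never leaves it, so it can be pulled back edge by
    -- edge.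
    have key : ∀ y, Reaches (mapEdges f E) (f a) y → ∃ c, f c = y ∧ Reaches E a c := by
      intro y hy
      induction hy with
      | refl => exact ⟨a, rfl, .refl⟩
      | tail _ hE ih =>
        obtain ⟨c, rfl, hc⟩ := ih
        obtain ⟨⟨p, q⟩, hpq, he⟩ := mem_map.1 hE
        simp only [Function.Embedding.coe_prodMap, Prod.map_apply, Prod.mk.injEq] at he
        obtain rfl : p = c := f.injective he.1
        exact ⟨q, he.2, hc.tail hpq⟩
    obtain ⟨c, hc, h'⟩ := key _ h
    rwa [← f.injective hc]
  · intro h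
    exact Relation.ReflTransGen.lift f (fun _ _ hE => mk_mem_mapEdges.2 hE) _ _ h

theorem scc_map {S : Finset α} {E : Finset (α × α)} (f : α ↪o β) (a : α) :
    scc (S.map f.toEmbedding) (mapEdges f E) (f a) = (scc S E a).map f.toEmbedding := by
  ext y
  simp only [mem_scc, mem_map]
  constructor
  · rintro ⟨⟨x, hx, rfl⟩, h1, h2⟩
    exact ⟨x, ⟨hx, (reaches_map f).1 h1, (reaches_map f).1 h2⟩, rfl⟩
  · rintro ⟨x, ⟨hx, h1, h2⟩, rfl⟩
    exact ⟨⟨x, hx, rfl⟩, (reaches_map f).2 h1, (reaches_map f).2 h2⟩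

theorem comps_map {S : Finset α} {E : Finset (α × α)} (f : α ↪o β) :
    comps (S.map f.toEmbedding) (mapEdges f E) =
      (comps S E).map (mapEmbedding f.toEmbedding).toEmbedding := by
  simp only [comps, map_eq_image, image_image]
  refine image_congr fun a _ => ?_
  have := scc_map (S := S) (E := E) f a
  simp only [map_eq_image] at this
  simpa [map_eq_image] using this

/-! ### Weighted sums and their invariance under relabelling -/

section Weights

variable {R : Type*} [CommRing R] (x y : R) (B : Family)

/-- The weight of a digraph: `x` for each edge and `y` for each component belonging to `B`. -/
def weight (S : Finset α) (E : Finset (α × α)) : R :=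
  x ^ E.card * ∏ C ∈ comps S E, if Belongs B C E then y else 1

/-- The digraph is strongly connected. -/
def Strong (S : Finset α) (E : Finset (α × α)) : Prop :=
  S.Nonempty ∧ ∀ a ∈ S, ∀ b ∈ S, Reaches E a b

/-- The digraph is a disjoint union of strongly connected ones. -/
def Balanced (E : Finset (α × α)) : Prop :=
  ∀ a b, (a, b) ∈ E → Reaches E b a

/-- The weighted sum of all digraphs on `S`. -/
def sumAll (S : Finset α) : R :=
  ∑ E ∈ S.offDiag.powerset, weight x y B S E

/-- The weighted sum of the strongly connected digraphs on `S`. -/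
def sumStrong (S : Finset α) : R :=
  ∑ E ∈ S.offDiag.powerset, if Strong S E then weight x y B S E else 0

/-- The weighted sum of the disjoint unions of strongly connected digraphs on `S`, signed by the
number of components. -/
def sumBalanced (S : Finset α) : R :=
  ∑ E ∈ S.offDiag.powerset,
    if Balanced E then (-1) ^ (comps S E).card * weight x y B S E else 0

theorem weight_map (S : Finset α) (E : Finset (α × α)) (f : α ↪o β) :
    weight x y B (S.map f.toEmbedding) (mapEdges f E) = weight x y B S E := by
  unfold weight
  rw [comps_map, prod_map, card_map]
  congr 1
  refine prod_congr rfl fun C _ => ?_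
  have := belongs_map (B := B) (C := C) (E := E) f
  simp only [RelEmbedding.coe_toEmbedding, mapEmbedding_apply, this]

theorem strong_map (S : Finset α) (E : Finset (α × α)) (f : α ↪o β) :
    Strong (S.map f.toEmbedding) (mapEdges f E) ↔ Strong S E := by
  simp only [Strong, map_nonempty, forall_mem_map, RelEmbedding.coe_toEmbedding, reaches_map]

theorem balanced_map (E : Finset (α × α)) (f : α ↪o β) :
    Balanced (mapEdges f E) ↔ Balanced E := by
  constructor
  · intro h a b hab
    exact (reaches_map f).1 (h _ _ (mk_mem_mapEdges.2 hab))
  · intro h a b hab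
    obtain ⟨⟨p, q⟩, hpq, he⟩ := mem_map.1 hab
    obtain ⟨rfl, rfl⟩ := Prod.mk.inj he
    exact (reaches_map f).2 (h _ _ hpq)

theorem sum_powerset_offDiag_map {M : Type*} [AddCommMonoid M] (S : Finset α) (f : α ↪o β)
    (F : Finset (β × β) → M) :
    ∑ E ∈ (S.map f.toEmbedding).offDiag.powerset, F E =
      ∑ E ∈ S.offDiag.powerset, F (mapEdges f E) := by
  have h : (S.map f.toEmbedding).offDiag.powerset =
      S.offDiag.powerset.map
        (mapEmbedding (f.toEmbedding.prodMap f.toEmbedding)).toEmbedding := by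
    ext E
    simp only [mem_powerset, mem_map, RelEmbedding.coe_toEmbedding, mapEmbedding_apply]
    rw [show (S.map f.toEmbedding).offDiag = mapEdges f S.offDiag from ?_, subset_map_iff]
    · exact exists_congr fun _ => and_congr_right fun _ => eq_comm
    · ext ⟨a, b⟩
      simp only [mem_offDiag, mem_map, mapEdges, Prod.exists, Function.Embedding.coe_prodMap,
        Prod.map_apply, Prod.mk.injEq]
      constructor
      · rintro ⟨⟨p, hp, rfl⟩, ⟨q, hq, rfl⟩, hne⟩
        exact ⟨p, q, ⟨hp, hq, fun h => hne (by rw [h])⟩, rfl, rfl⟩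
      · rintro ⟨p, q, ⟨hp, hq, hne⟩, rfl, rfl⟩
        exact ⟨⟨p, hp, rfl⟩, ⟨q, hq, rfl⟩, fun h => hne (f.injective h)⟩
  rw [h, sum_map]
  rfl

theorem sumAll_map (S : Finset α) (f : α ↪o β) :
    sumAll x y B (S.map f.toEmbedding) = sumAll x y B S := by
  simp only [sumAll, sum_powerset_offDiag_map, weight_map]

theorem sumStrong_map (S : Finset α) (f : α ↪o β) :
    sumStrong x y B (S.map f.toEmbedding) = sumStrong x y B S := by
  simp only [sumStrong, sum_powerset_offDiag_map, weight_map, strong_map]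

theorem sumBalanced_map (S : Finset α) (f : α ↪o β) :
    sumBalanced x y B (S.map f.toEmbedding) = sumBalanced x y B S := by
  simp only [sumBalanced, sum_powerset_offDiag_map, weight_map, balanced_map, comps_map, card_map]

theorem map_univ_orderEmbOfFin (S : Finset α) :
    univ.map (S.orderEmbOfFin rfl).toEmbedding = S := by
  ext a
  simp

/-- Dependence on the cardinality alone is what later turns sums over subsets into binomial sums. -/
theorem sumAll_eq (S : Finset α) :
    sumAll x y B S = sumAll x y B (univ : Finset (Fin S.card)) := by
  conv_lhs => rw [← map_univ_orderEmbOfFin S, sumAll_map]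

theorem sumStrong_eq (S : Finset α) :
    sumStrong x y B S = sumStrong x y B (univ : Finset (Fin S.card)) := by
  conv_lhs => rw [← map_univ_orderEmbOfFin S, sumStrong_map]

theorem sumBalanced_eq (S : Finset α) :
    sumBalanced x y B S = sumBalanced x y B (univ : Finset (Fin S.card)) := by
  conv_lhs => rw [← map_univ_orderEmbOfFin S, sumBalanced_map]

end Weights

end EdgeSets

/-! ### Digraphs on `U ∪ T` without edges from `T` to `U` -/

section Splitting

set_option linter.unusedSectionVars false

open Classical Finset

variable {α : Type*} [LinearOrder α]

/-- The edge set of a digraph on `U ∪ T` without edges from `T` to `U` consists of a digraph on `U`,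
a digraph on `T` and edges from `U` to `T`. -/
structure IsSplit (U T : Finset α) (E₁ E₂ X : Finset (α × α)) : Prop where
  disjoint : Disjoint U T
  left : E₁ ⊆ U.offDiag
  right : E₂ ⊆ T.offDiag
  cross : X ⊆ U ×ˢ T

namespace IsSplit

variable {U T : Finset α} {E₁ E₂ X : Finset (α × α)}

theorem mem_right (h : IsSplit U T E₁ E₂ X) {a b : α} (ha : a ∈ T) :
    (a, b) ∈ E₁ ∪ E₂ ∪ X ↔ (a, b) ∈ E₂ := by
  have haU : a ∉ U := fun h' => disjoint_left.1 h.disjoint h' ha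
  simp only [mem_union]
  constructor
  · rintro ((h' | h') | h')
    · exact absurd (mem_offDiag.1 (h.left h')).1 haU
    · exact h'
    · exact absurd (mem_product.1 (h.cross h')).1 haU
  · exact fun h' => .inl (.inr h')

theorem mem_left (h : IsSplit U T E₁ E₂ X) {a b : α} (hb : b ∈ U) :
    (a, b) ∈ E₁ ∪ E₂ ∪ X ↔ (a, b) ∈ E₁ := by
  have hbT : b ∉ T := disjoint_left.1 h.disjoint hb
  simp only [mem_union]
  constructor
  · rintro ((h' | h') | h')
    · exact h'
    · exact absurd (mem_offDiag.1 (h.right h')).2.1 hbT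
    · exact absurd (mem_product.1 (h.cross h')).2 hbT
  · exact fun h' => .inl (.inl h')

/-- No edge leaves `T`, so a path that starts there stays there; dually, a path that ends in `U`
lies in `U`. -/
theorem reaches_right (h : IsSplit U T E₁ E₂ X) {a b : α} (ha : a ∈ T)
    (hab : Reaches (E₁ ∪ E₂ ∪ X) a b) : b ∈ T ∧ Reaches E₂ a b := by
  induction hab with
  | refl => exact ⟨ha, .refl⟩
  | tail _ hE ih =>
    have h' := (h.mem_right ih.1).1 hE
    exact ⟨(mem_offDiag.1 (h.right h')).2.1, ih.2.tail h'⟩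

theorem reaches_left (h : IsSplit U T E₁ E₂ X) {a b : α} (hb : b ∈ U)
    (hab : Reaches (E₁ ∪ E₂ ∪ X) a b) : a ∈ U ∧ Reaches E₁ a b := by
  induction hab using Relation.ReflTransGen.head_induction_on with
  | refl => exact ⟨hb, .refl⟩
  | head hE _ ih =>
    have h' := (h.mem_left ih.1).1 hE
    exact ⟨(mem_offDiag.1 (h.left h')).1, ih.2.head h'⟩

theorem scc_left (h : IsSplit U T E₁ E₂ X) {a : α} (ha : a ∈ U) :
    scc (U ∪ T) (E₁ ∪ E₂ ∪ X) a = scc U E₁ a := by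
  ext b
  simp only [mem_scc]
  have hsub : E₁ ⊆ E₁ ∪ E₂ ∪ X := subset_union_left.trans subset_union_left
  constructor
  · rintro ⟨-, h1, h2⟩
    obtain ⟨hb, h2'⟩ := h.reaches_left ha h2
    exact ⟨hb, (h.reaches_left hb h1).2, h2'⟩
  · rintro ⟨hb, h1, h2⟩
    exact ⟨mem_union_left _ hb, h1.mono hsub, h2.mono hsub⟩

theorem scc_right (h : IsSplit U T E₁ E₂ X) {a : α} (ha : a ∈ T) :
    scc (U ∪ T) (E₁ ∪ E₂ ∪ X) a = scc T E₂ a := by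
  ext b
  simp only [mem_scc]
  have hsub : E₂ ⊆ E₁ ∪ E₂ ∪ X := subset_union_right.trans subset_union_left
  constructor
  · rintro ⟨-, h1, h2⟩
    obtain ⟨hb, h1'⟩ := h.reaches_right ha h1
    exact ⟨hb, h1', (h.reaches_right hb h2).2⟩
  · rintro ⟨hb, h1, h2⟩
    exact ⟨mem_union_right _ hb, h1.mono hsub, h2.mono hsub⟩

/-- A path that has passed from `U` to `T` cannot return, so no component meets both sides and the
edges in `X` affect none. -/
theorem comps_eq (h : IsSplit U T E₁ E₂ X) :
    comps (U ∪ T) (E₁ ∪ E₂ ∪ X) = comps U E₁ ∪ comps T E₂ := by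
  rw [comps, image_union]
  congr 1
  · exact image_congr fun a ha => h.scc_left ha
  · exact image_congr fun a ha => h.scc_right ha

theorem card_comps (h : IsSplit U T E₁ E₂ X) :
    (comps (U ∪ T) (E₁ ∪ E₂ ∪ X)).card = (comps U E₁).card + (comps T E₂).card := by
  rw [h.comps_eq, card_union_of_disjoint (disjoint_comps h.disjoint _ _)]

theorem card_edges (h : IsSplit U T E₁ E₂ X) :
    (E₁ ∪ E₂ ∪ X).card = E₁.card + E₂.card + X.card := by
  have hd := disjoint_left.1 h.disjoint
  rw [card_union_of_disjoint, card_union_of_disjoint]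
  · rw [disjoint_left]
    intro p h1 h2
    exact hd (mem_offDiag.1 (h.left h1)).1 (mem_offDiag.1 (h.right h2)).1
  · rw [disjoint_left]
    intro p h1 h2
    have h2 := mem_product.1 (h.cross h2)
    rcases mem_union.1 h1 with h1 | h1
    · exact hd (mem_offDiag.1 (h.left h1)).2.1 h2.2
    · exact hd h2.1 (mem_offDiag.1 (h.right h1)).1

theorem weight_eq {R : Type*} [CommRing R] (x y : R) (B : Family) (h : IsSplit U T E₁ E₂ X) :
    weight x y B (U ∪ T) (E₁ ∪ E₂ ∪ X) =
      weight x y B U E₁ * (x ^ X.card * weight x y B T E₂) := by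
  unfold weight
  rw [h.card_edges, h.comps_eq, prod_union (disjoint_comps h.disjoint _ _)]
  have h1 : ∀ C ∈ comps U E₁, (if Belongs B C (E₁ ∪ E₂ ∪ X) then y else 1) =
      if Belongs B C E₁ then y else 1 := fun C hC => by
    rw [belongs_congr fun a _ b hb => h.mem_left (subset_of_mem_comps hC hb)]
  have h2 : ∀ C ∈ comps T E₂, (if Belongs B C (E₁ ∪ E₂ ∪ X) then y else 1) =
      if Belongs B C E₂ then y else 1 := fun C hC => by
    rw [belongs_congr fun a ha b _ => h.mem_right (subset_of_mem_comps hC ha)]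
  rw [prod_congr rfl h1, prod_congr rfl h2]
  ring

end IsSplit

theorem sum_powerset_union {γ M : Type*} [DecidableEq γ] [AddCommMonoid M] {P Q : Finset γ}
    (h : Disjoint P Q) (F : Finset γ → M) :
    ∑ E ∈ (P ∪ Q).powerset, F E = ∑ E₁ ∈ P.powerset, ∑ E₂ ∈ Q.powerset, F (E₁ ∪ E₂) := by
  rw [← sum_product']
  symm
  refine sum_bij' (fun p _ => p.1 ∪ p.2) (fun E _ => (E ∩ P, E ∩ Q)) ?_ ?_ ?_ ?_ ?_
  · rintro ⟨E₁, E₂⟩ hp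
    simp only [mem_product, mem_powerset] at hp ⊢
    exact union_subset_union hp.1 hp.2
  · intro E _
    simp [inter_subset_right]
  · rintro ⟨E₁, E₂⟩ hp
    simp only [mem_product, mem_powerset] at hp
    have h1 : E₂ ∩ P = ∅ := disjoint_iff_inter_eq_empty.1 (h.symm.mono_left hp.2)
    have h2 : E₁ ∩ Q = ∅ := disjoint_iff_inter_eq_empty.1 (h.mono_left hp.1)
    simp only [union_inter_distrib_right, h1, h2, inter_eq_left.2 hp.1, inter_eq_left.2 hp.2,
      union_empty, empty_union]
  · intro E hE
    simp only [mem_powerset] at hE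
    rw [← inter_union_distrib_left, inter_eq_left.2 hE]
  · simp

/-- The possible edges form four blocks; `hF` discards every edge set that meets the block from `T`
to `U`, and the other three blocks are chosen independently. -/
theorem sum_split {M : Type*} [AddCommMonoid M] {U T : Finset α} (h : Disjoint U T)
    (F : Finset (α × α) → M)
    (hF : ∀ E ⊆ (U ∪ T).offDiag, (∃ a ∈ T, ∃ b ∈ U, (a, b) ∈ E) → F E = 0) :
    ∑ E ∈ (U ∪ T).offDiag.powerset, F E =
      ∑ E₁ ∈ U.offDiag.powerset, ∑ E₂ ∈ T.offDiag.powerset, ∑ X ∈ (U ×ˢ T).powerset,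
        F (E₁ ∪ E₂ ∪ X) := by
  have hd := disjoint_left.1 h
  have h1 : Disjoint U.offDiag T.offDiag := by
    rw [disjoint_left]
    intro p h1 h2
    exact hd (mem_offDiag.1 h1).1 (mem_offDiag.1 h2).1
  have h2 : Disjoint (U.offDiag ∪ T.offDiag) (U ×ˢ T) := by
    rw [disjoint_left]
    intro p h1 h2
    have h2 := mem_product.1 h2
    rcases mem_union.1 h1 with h1 | h1
    · exact hd (mem_offDiag.1 h1).2.1 h2.2
    · exact hd h2.1 (mem_offDiag.1 h1).1
  rw [← sum_powerset_union h1 fun E => ∑ X ∈ (U ×ˢ T).powerset, F (E ∪ X),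
    ← sum_powerset_union h2 F]
  symm
  refine sum_subset (powerset_mono.2 ?_) fun E hE hE' => hF E (mem_powerset.1 hE) ?_
  · refine union_subset (union_subset ?_ ?_) ?_
    · exact offDiag_mono subset_union_left
    · exact offDiag_mono subset_union_right
    · rintro ⟨a, b⟩ hab
      obtain ⟨ha, hb⟩ := mem_product.1 hab
      exact mem_offDiag.2 ⟨mem_union_left _ ha, mem_union_right _ hb,
        fun hab => hd ha (by simp only at hab; rwa [hab])⟩
  · rw [mem_powerset, not_subset] at hE'
    obtain ⟨⟨a, b⟩, hab, hn⟩ := hE'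
    obtain ⟨ha, hb, hne⟩ := mem_offDiag.1 (mem_powerset.1 hE hab)
    simp only [mem_union, mem_offDiag, mem_product] at ha hb hn hne
    exact ⟨a, by tauto, b, by tauto, hab⟩

theorem sum_powerset_pow_card {R γ : Type*} [CommRing R] (x : R) (P : Finset γ) :
    ∑ X ∈ P.powerset, x ^ X.card = (1 + x) ^ P.card := by
  have := (prod_one_add (s := P) (f := fun _ => x)).symm
  simpa using this

end Splitting

/-! ### Source components and the two recursions -/

section Recursions

set_option linter.unusedSectionVars false

open Classical Finset

variable {α : Type*} [LinearOrder α]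

theorem Strong.scc_eq {S : Finset α} {E : Finset (α × α)} (h : Strong S E) {v : α} (hv : v ∈ S) :
    scc S E v = S :=
  (scc_subset _ _ _).antisymm fun x hx => mem_scc.2 ⟨hx, h.2 v hv x hx, h.2 x hx v hv⟩

theorem strong_of_scc_eq {S : Finset α} {E : Finset (α × α)} {v : α} (hv : v ∈ S)
    (h : scc S E v = S) : Strong S E :=
  ⟨⟨v, hv⟩, fun a ha b hb => by
    rw [← h] at ha hb
    exact (mem_scc.1 ha).2.2.trans (mem_scc.1 hb).2.1⟩

theorem Strong.comps_eq {S : Finset α} {E : Finset (α × α)} (h : Strong S E) :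
    comps S E = {S} := by
  ext C
  simp only [comps, mem_image, mem_singleton]
  constructor
  · rintro ⟨v, hv, rfl⟩
    exact h.scc_eq hv
  · rintro rfl
    obtain ⟨v, hv⟩ := h.1
    exact ⟨v, hv, h.scc_eq hv⟩

/-- The set `U` is a union of source-like components: it is closed under predecessors, and the
edges that end in `U` lie inside components. -/
def IsSourceUnion (E : Finset (α × α)) (U : Finset α) : Prop :=
  ∀ a b, (a, b) ∈ E → b ∈ U → a ∈ U ∧ Reaches E b a

theorem IsSourceUnion.reaches {E : Finset (α × α)} {U : Finset α} (h : IsSourceUnion E U)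
    {a b : α} (hab : Reaches E a b) (hb : b ∈ U) : a ∈ U := by
  induction hab using Relation.ReflTransGen.head_induction_on with
  | refl => exact hb
  | head hE _ ih => exact (h _ _ hE ih).1

/-- Every nonempty digraph has a source-like component. -/
theorem exists_source {S : Finset α} (hS : S.Nonempty) (E : Finset (α × α)) :
    ∃ v ∈ S, ∀ a ∈ S, Reaches E a v → Reaches E v a := by
  -- Take `v` reached from the fewest vertices. If `a` reaches `v`, whatever reaches `a` reaches
  -- `v`; by minimality the two sets agree, so `v` reaches `a`.
  obtain ⟨v, hv, hmin⟩ := exists_min_image S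
    (fun v => (S.filter fun a => Reaches E a v).card) hS
  refine ⟨v, hv, fun a ha hav => ?_⟩
  have hsub : (S.filter fun b => Reaches E b a) ⊆ S.filter fun b => Reaches E b v := by
    intro b hb
    simp only [mem_filter] at hb ⊢
    exact ⟨hb.1, hb.2.trans hav⟩
  have heq := eq_of_subset_of_card_le hsub (hmin a ha)
  have : v ∈ S.filter fun b => Reaches E b v := mem_filter.2 ⟨hv, .refl⟩
  rw [← heq] at this
  exact (mem_filter.1 this).2

section Toggle

variable {S : Finset α} {E : Finset (α × α)} {v : α}

/-- By `hsrc` every edge into the component of `v` starts inside it. Conversely, an edge from that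
component into a source union `U` would have a return path, putting its head in the component,
against disjointness. -/
theorem isSourceUnion_union_scc (hE : E ⊆ S.offDiag)
    (hsrc : ∀ a ∈ S, Reaches E a v → Reaches E v a) {U : Finset α}
    (hd : Disjoint U (scc S E v)) :
    IsSourceUnion E (U ∪ scc S E v) ↔ IsSourceUnion E U := by
  constructor
  · intro h a b hab hb
    obtain ⟨ha, hba⟩ := h a b hab (mem_union_left _ hb)
    refine ⟨(mem_union.1 ha).resolve_right fun ha' => ?_, hba⟩
    obtain ⟨-, h1, h2⟩ := mem_scc.1 ha'
    exact disjoint_left.1 hd hb (mem_scc.2 ⟨(mem_offDiag.1 (hE hab)).2.1,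
      h1.tail hab, hba.trans h2⟩)
  · intro h a b hab hb
    rcases mem_union.1 hb with hb | hb
    · exact ⟨mem_union_left _ (h a b hab hb).1, (h a b hab hb).2⟩
    · obtain ⟨-, h1, h2⟩ := mem_scc.1 hb
      have haS := (mem_offDiag.1 (hE hab)).1
      have hav : Reaches E a v := Relation.ReflTransGen.head hab h2
      have hva := hsrc a haS hav
      exact ⟨mem_union_right _ (mem_scc.2 ⟨haS, hva, hav⟩), h2.trans hva⟩

theorem card_image_union_scc (hv : v ∈ S) {U : Finset α}
    (hU : U ⊆ S) (hd : Disjoint U (scc S E v)) :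
    ((U ∪ scc S E v).image (scc S E)).card = (U.image (scc S E)).card + 1 := by
  have h1 : (scc S E v).image (scc S E) = {scc S E v} := by
    ext C
    simp only [mem_image, mem_singleton]
    constructor
    · rintro ⟨x, hx, rfl⟩
      exact scc_eq_of_mem hx
    · rintro rfl
      exact ⟨v, self_mem_scc hv, rfl⟩
  rw [image_union, h1, card_union_of_disjoint, card_singleton]
  rw [disjoint_singleton_right, mem_image]
  rintro ⟨x, hx, hxv⟩
  exact disjoint_left.1 hd hx (hxv ▸ self_mem_scc (hU hx))

/-- Closure under predecessors makes `U` contain every component it meets. -/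
theorem IsSourceUnion.disjoint_or_subset {U : Finset α} (h : IsSourceUnion E U) :
    Disjoint U (scc S E v) ∨ scc S E v ⊆ U := by
  by_cases hd : Disjoint U (scc S E v)
  · exact .inl hd
  · obtain ⟨x, hxU, hx⟩ := not_disjoint_iff.1 hd
    obtain ⟨-, h1, h2⟩ := mem_scc.1 hx
    refine .inr fun y hy => ?_
    obtain ⟨-, -, h4⟩ := mem_scc.1 hy
    exact h.reaches (h4.trans h1) hxU

end Toggle

/-- Sign-reversing involution: add or remove one fixed source component `C`, which changes the
number of chosen components by one. -/
theorem sum_sign_isSourceUnion {R : Type*} [CommRing R] {S : Finset α} (hS : S.Nonempty)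
    {E : Finset (α × α)} (hE : E ⊆ S.offDiag) :
    ∑ U ∈ S.powerset, (if IsSourceUnion E U then (-1 : R) ^ (U.image (scc S E)).card else 0) =
      0 := by
  obtain ⟨v, hv, hsrc⟩ := exists_source hS E
  set C := scc S E v with hC
  have hCS : C ⊆ S := scc_subset _ _ _
  have hne : C.Nonempty := ⟨v, self_mem_scc hv⟩
  have hsum : ∀ U ⊆ S, Disjoint U C →
      (if IsSourceUnion E U then (-1 : R) ^ (U.image (scc S E)).card else 0) +
      (if IsSourceUnion E (U ∪ C) then (-1 : R) ^ ((U ∪ C).image (scc S E)).card else 0) = 0 := by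
    intro U hU hd
    simp only [hC, isSourceUnion_union_scc hE hsrc hd, card_image_union_scc hv hU hd]
    split_ifs <;> ring
  refine sum_involution (fun U _ => symmDiff U C) ?_ ?_ ?_ ?_
  · intro U hU
    rw [mem_powerset] at hU
    by_cases hd : Disjoint U C
    · rw [show symmDiff U C = U ∪ C from hd.symmDiff_eq_sup]
      exact hsum U hU hd
    by_cases hs : C ⊆ U
    · rw [show symmDiff U C = U \ C from symmDiff_of_ge hs, add_comm]
      have := hsum (U \ C) (sdiff_subset.trans hU) sdiff_disjoint
      rwa [sdiff_union_of_subset hs] at this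
    -- If `U` cuts `C` properly, so does `symmDiff U C`; neither is a source union and both terms
    -- vanish.
    · rw [if_neg fun h => (h.disjoint_or_subset (S := S) (v := v)).elim hd hs, if_neg, add_zero]
      intro h
      rcases h.disjoint_or_subset (S := S) (v := v) with h | h
      · refine hs fun x hx => ?_
        have := disjoint_right.1 h hx
        rw [mem_symmDiff] at this
        tauto
      · refine hd (disjoint_right.2 fun x hx => ?_)
        have := h hx
        rw [mem_symmDiff] at this
        tauto
  · intro U _ _ h
    obtain ⟨x, hx⟩ := hne
    have := congrArg (x ∈ ·) h
    simp only [mem_symmDiff, eq_iff_iff] at this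
    tauto
  · intro U hU
    rw [mem_powerset] at hU ⊢
    intro x hx
    rw [mem_symmDiff] at hx
    exact hx.elim (fun h => hU h.1) fun h => hCS h.1
  · intro U _
    exact symmDiff_symmDiff_cancel_right C U

variable {R : Type*} [CommRing R] (x y : R) (B : Family)

theorem IsSplit.isSourceUnion_iff {U T : Finset α} {E₁ E₂ X : Finset (α × α)}
    (h : IsSplit U T E₁ E₂ X) : IsSourceUnion (E₁ ∪ E₂ ∪ X) U ↔ Balanced E₁ := by
  constructor
  · intro hs a b hab
    obtain ⟨ha, hb, -⟩ := mem_offDiag.1 (h.left hab)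
    exact (h.reaches_left ha (hs a b ((h.mem_left hb).2 hab) hb).2).2
  · intro hs a b hab hb
    have hab := (h.mem_left hb).1 hab
    exact ⟨(mem_offDiag.1 (h.left hab)).1,
      (hs a b hab).mono (subset_union_left.trans subset_union_left)⟩

/-- When `U` is a source union, the digraph is balanced on `U`, arbitrary on `T`, and has arbitrary
edges from `U` to `T`; these last contribute the power of `1 + x`. -/
theorem sum_isSourceUnion_weight {U T : Finset α} (h : Disjoint U T) :
    ∑ E ∈ (U ∪ T).offDiag.powerset,
      (if IsSourceUnion E U then (-1 : R) ^ (U.image (scc (U ∪ T) E)).card else 0) *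
        weight x y B (U ∪ T) E =
      sumBalanced x y B U * ((1 + x) ^ (U.card * T.card) * sumAll x y B T) := by
  rw [sum_split h]
  · rw [sumBalanced, sumAll, ← card_product, ← sum_powerset_pow_card, sum_mul]
    refine sum_congr rfl fun E₁ hE₁ => ?_
    rw [mul_comm (∑ X ∈ (U ×ˢ T).powerset, x ^ X.card), sum_mul, mul_sum]
    refine sum_congr rfl fun E₂ hE₂ => ?_
    rw [mul_sum, mul_sum]
    refine sum_congr rfl fun X hX => ?_
    have hs : IsSplit U T E₁ E₂ X :=
      ⟨h, mem_powerset.1 hE₁, mem_powerset.1 hE₂, mem_powerset.1 hX⟩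
    have him : U.image (scc (U ∪ T) (E₁ ∪ E₂ ∪ X)) = comps U E₁ :=
      image_congr fun a ha => hs.scc_left ha
    rw [hs.weight_eq, him]
    simp only [hs.isSourceUnion_iff]
    split_ifs <;> ring
  · rintro E - ⟨a, ha, b, hb, hab⟩
    rw [if_neg, zero_mul]
    exact fun hs => disjoint_left.1 h (hs a b hab hb).1 ha

/-- Every nonempty digraph has a source-like component, so that the signed sum over all digraphs
with a distinguished set of source-like components vanishes. -/
theorem sum_sumBalanced_mul_sumAll {S : Finset α} (hS : S.Nonempty) :
    ∑ U ∈ S.powerset, sumBalanced x y B U *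
      ((1 + x) ^ (U.card * (S \ U).card) * sumAll x y B (S \ U)) = 0 := by
  have h1 : ∀ U ∈ S.powerset, sumBalanced x y B U *
      ((1 + x) ^ (U.card * (S \ U).card) * sumAll x y B (S \ U)) =
      ∑ E ∈ S.offDiag.powerset,
        (if IsSourceUnion E U then (-1 : R) ^ (U.image (scc S E)).card else 0) *
          weight x y B S E := fun U hU => by
    rw [← sum_isSourceUnion_weight x y B disjoint_sdiff,
      union_sdiff_of_subset (mem_powerset.1 hU)]
  -- After the exchange the digraph is fixed and `U` varies, which is the setting of the involution.
  rw [sum_congr rfl h1, sum_comm]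
  refine sum_eq_zero fun E hE => ?_
  rw [← sum_mul, sum_sign_isSourceUnion hS (mem_powerset.1 hE), zero_mul]

/-- Balance forbids edges between `U`, the component of `v`, and `T`, so the weight factors; the
minus sign is the share of the component `U` itself. -/
theorem sum_balanced_scc {U T : Finset α} (h : Disjoint U T) {v : α} (hv : v ∈ U) :
    ∑ E ∈ (U ∪ T).offDiag.powerset,
      (if scc (U ∪ T) E v = U then
        (if Balanced E then (-1) ^ (comps (U ∪ T) E).card * weight x y B (U ∪ T) E else 0)
        else 0) = -(sumStrong x y B U * sumBalanced x y B T) := by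
  rw [sum_split h]
  · rw [sumStrong, sumBalanced, sum_mul, ← sum_neg_distrib]
    refine sum_congr rfl fun E₁ hE₁ => ?_
    rw [mul_sum, ← sum_neg_distrib]
    refine sum_congr rfl fun E₂ hE₂ => ?_
    have hs : ∀ X ∈ (U ×ˢ T).powerset, IsSplit U T E₁ E₂ X := fun X hX =>
      ⟨h, mem_powerset.1 hE₁, mem_powerset.1 hE₂, mem_powerset.1 hX⟩
    have h0 : (∅ : Finset (α × α)) ∈ (U ×ˢ T).powerset := empty_mem_powerset _
    rw [sum_eq_single_of_mem ∅ h0]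
    · have hs := hs ∅ h0
      have hstrong : scc U E₁ v = U ↔ Strong U E₁ := ⟨strong_of_scc_eq hv, fun h => h.scc_eq hv⟩
      rw [hs.scc_left hv, hs.card_comps, hs.weight_eq]
      simp only [hstrong]
      by_cases hst : Strong U E₁
      · have hbal : Balanced (E₁ ∪ E₂ ∪ ∅) ↔ Balanced E₂ := by
          rw [union_empty]
          constructor
          · intro hb a b hab
            have hbT := (mem_offDiag.1 (hs.right hab)).2.1
            have := hb a b (mem_union_right _ hab)
            rw [← union_empty (E₁ ∪ E₂)] at this
            exact (hs.reaches_right hbT this).2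
          · intro hb a b hab
            rcases mem_union.1 hab with hab | hab
            · obtain ⟨ha, hb, -⟩ := mem_offDiag.1 (hs.left hab)
              exact (hst.2 b hb a ha).mono subset_union_left
            · exact (hb a b hab).mono subset_union_right
        simp only [hst, if_true, hbal, hst.comps_eq, card_singleton, card_empty, pow_zero, one_mul]
        split_ifs <;> ring
      · simp [hst]
    -- A cross edge would need a path back from `T` to `U`.
    · intro X hX hne
      obtain ⟨⟨a, b⟩, hab⟩ := nonempty_iff_ne_empty.2 hne
      have hs := hs X hX
      obtain ⟨ha, hb⟩ := mem_product.1 (hs.cross hab)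
      rw [if_neg (c := Balanced _), ite_self]
      intro hbal
      exact disjoint_left.1 h ha (hs.reaches_right hb (hbal a b (mem_union_right _ hab))).1
  · rintro E - ⟨a, ha, b, hb, hab⟩
    by_cases hbal : Balanced E
    · rw [if_neg]
      intro hv'
      have hb' := hb
      rw [← hv', mem_scc] at hb'
      have haU : a ∈ scc (U ∪ T) E v := mem_scc.2 ⟨mem_union_right _ ha,
        hb'.2.1.trans (hbal a b hab), Relation.ReflTransGen.head hab hb'.2.2⟩
      rw [hv'] at haU
      exact disjoint_left.1 h haU ha
    · rw [if_neg hbal, ite_self]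

/-- Splitting off the component of a vertex from a disjoint union of strongly connected
digraphs. -/
theorem sumBalanced_insert {S : Finset α} {v : α} (hv : v ∉ S) :
    sumBalanced x y B (insert v S) =
      -∑ C ∈ S.powerset, sumStrong x y B (insert v C) * sumBalanced x y B (S \ C) := by
  have h1 : ∀ C ∈ S.powerset, -(sumStrong x y B (insert v C) * sumBalanced x y B (S \ C)) =
      ∑ E ∈ (insert v S).offDiag.powerset,
        (if scc (insert v S) E v = insert v C then
          (if Balanced E then (-1) ^ (comps (insert v S) E).card * weight x y B (insert v S) E
            else 0) else 0) := fun C hC => by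
    have hd : Disjoint (insert v C) (S \ C) := by
      rw [disjoint_insert_left]
      exact ⟨fun h => hv (mem_sdiff.1 h).1, disjoint_sdiff⟩
    rw [← sum_balanced_scc x y B hd (mem_insert_self v C), insert_union,
      union_sdiff_of_subset (mem_powerset.1 hC)]
  rw [← sum_neg_distrib, sum_congr rfl h1, sum_comm, sumBalanced]
  refine sum_congr rfl fun E _ => ?_
  have hvE : v ∈ scc (insert v S) E v := self_mem_scc (mem_insert_self v S)
  -- For a given `E` only one `C` contributes: the component of `v` with `v` removed.
  rw [sum_eq_single_of_mem ((scc (insert v S) E v).erase v), insert_erase hvE, if_pos rfl]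
  · rw [mem_powerset, ← subset_insert_iff]
    exact scc_subset _ _ _
  · intro C hC hne
    rw [if_neg]
    intro h
    rw [h, erase_insert fun h' => hv (mem_powerset.1 hC h')] at hne
    exact hne rfl

end Recursions

/-! ### From labelled digraphs to edge sets, and binomial recurrences -/

section Digraphs

open Classical Finset

variable {n : ℕ}

/-- The edges of a labelled digraph. -/
def LDigraph.edges (G : LDigraph n) : Finset (Fin n × Fin n) :=
  univ.filter fun p => G.1.Adj p.1 p.2

theorem LDigraph.mem_edges {G : LDigraph n} {a b : Fin n} : (a, b) ∈ G.edges ↔ G.1.Adj a b := by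
  simp [LDigraph.edges]

theorem LDigraph.numEdges_eq (G : LDigraph n) : G.numEdges = G.edges.card := by
  rw [LDigraph.numEdges, ← Set.ncard_coe_finset]
  simp [LDigraph.edges]

theorem LDigraph.reach_iff (G : LDigraph n) (a b : Fin n) : G.Reach a b ↔ Reaches G.edges a b := by
  simp only [LDigraph.Reach, Reaches, LDigraph.mem_edges]

theorem sum_edges {M : Type*} [AddCommMonoid M] (F : Finset (Fin n × Fin n) → M) :
    ∑ G : LDigraph n, F G.edges = ∑ E ∈ (univ : Finset (Fin n)).offDiag.powerset, F E := by
  have hloop : ∀ E ∈ (univ : Finset (Fin n)).offDiag.powerset, ∀ v, (v, v) ∉ E :=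
    fun E hE v hv => (mem_offDiag.1 (mem_powerset.1 hE hv)).2.2 rfl
  refine sum_bij' (fun G _ => G.edges)
    (fun E hE => ⟨⟨fun a b => (a, b) ∈ E⟩, hloop E hE⟩) ?_ ?_ ?_ ?_ ?_
  · rintro G -
    rw [mem_powerset]
    rintro ⟨a, b⟩ hab
    refine mem_offDiag.2 ⟨mem_univ _, mem_univ _, fun h : a = b => ?_⟩
    subst h
    exact G.2 _ (LDigraph.mem_edges.1 hab)
  · intro E _
    exact mem_univ _
  · rintro G -
    apply Subtype.ext
    ext a b
    exact LDigraph.mem_edges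
  · intro E _
    ext ⟨a, b⟩
    exact LDigraph.mem_edges
  · intros
    rfl

/-- A finite linear order has only one increasing enumeration, so `f` must be `orderEmbOfFin`. -/
theorem LDigraph.sigma_relabelledInduce_eq (G : LDigraph n) (C : Finset (Fin n)) {k : ℕ}
    (H : LDigraph k) (f : Fin k ↪o Fin n) (hf : univ.map f.toEmbedding = C)
    (hadj : ∀ i j, H.1.Adj i j ↔ G.1.Adj (f i) (f j)) :
    (⟨C.card, G.relabelledInduce C⟩ : Σ n, LDigraph n) = ⟨k, H⟩ := by
  have hk : C.card = k := by simp [← hf]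
  subst hk
  have hfC : f = C.orderEmbOfFin rfl := by
    apply orderEmbOfFin_unique'
    intro i
    exact (congrArg (f i ∈ ·) hf).mp (by simp)
  congr 1
  apply Subtype.ext
  ext i j
  rw [hadj, hfC]
  rfl

theorem LDigraph.belongs_iff (G : LDigraph n) (B : Family) (C : Finset (Fin n)) :
    Belongs B C G.edges ↔ (⟨C.card, G.relabelledInduce C⟩ : Σ n, LDigraph n) ∈ B := by
  constructor
  · rintro ⟨⟨k, H⟩, hH, f, hf, hadj⟩
    rwa [G.sigma_relabelledInduce_eq C H f hf fun i j => by rw [hadj, LDigraph.mem_edges]]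
  · intro h
    exact ⟨_, h, C.orderEmbOfFin rfl, map_univ_orderEmbOfFin C, fun i j => by
      rw [LDigraph.mem_edges]; rfl⟩

theorem LDigraph.belongs_univ_iff (G : LDigraph n) (B : Family) :
    Belongs B univ G.edges ↔ (⟨n, G⟩ : Σ n, LDigraph n) ∈ B := by
  rw [G.belongs_iff, G.sigma_relabelledInduce_eq univ G (RelEmbedding.refl _)]
  · ext; simp
  · simp

theorem LDigraph.isComponent_iff (G : LDigraph n) (S : Finset (Fin n)) :
    G.IsComponent S ↔ S ∈ comps univ G.edges := by
  simp only [LDigraph.IsComponent, comps, mem_image, mem_univ, true_and, LDigraph.reach_iff]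
  refine exists_congr fun v => ?_
  rw [Finset.ext_iff]
  simp only [mem_scc, mem_univ, true_and]
  exact forall_congr' fun _ => iff_comm

theorem LDigraph.isStronglyConnected_iff (G : LDigraph n) :
    G.IsStronglyConnected ↔ Strong univ G.edges := by
  simp only [LDigraph.IsStronglyConnected, Strong, LDigraph.reach_iff, mem_univ, true_imp_iff,
    univ_nonempty_iff, Fin.pos_iff_nonempty]

theorem LDigraph.weight_edges {R : Type*} [CommRing R] (x y : R) (B : Family) (G : LDigraph n) :
    weight x y B univ G.edges = x ^ G.numEdges * y ^ numComponentsIn B G := by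
  have h : numComponentsIn B G =
      ((comps univ G.edges).filter fun C => Belongs B C G.edges).card := by
    rw [numComponentsIn, ← Set.ncard_coe_finset]
    simp only [coe_filter, LDigraph.isComponent_iff, LDigraph.belongs_iff]
  rw [weight, G.numEdges_eq, h, prod_ite, prod_const, prod_const_one, mul_one]

theorem countSeq_allDigraphs (B : Family) (n : ℕ) :
    countSeq allDigraphs (fun _ G => numComponentsIn B G) n =
      sumAll w u B (univ : Finset (Fin n)) := by
  rw [sumAll, ← sum_edges, countSeq]
  simp [allDigraphs, LDigraph.weight_edges]

/-- A strongly connected digraph has marked weight `u` if it is in `B` and 1 otherwise, that is, 1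
minus `1 - u` times the indicator of `B`. Others contribute to neither side, thanks to `hB`. -/
theorem countSeq_strong (B : Family) (hB : B ⊆ stronglyConnected) (n : ℕ) :
    (1 - u) * countSeq B (fun _ _ => 0) n - countSeq stronglyConnected (fun _ _ => 0) n =
      -sumStrong w u B (univ : Finset (Fin n)) := by
  rw [sumStrong, ← sum_edges, countSeq, countSeq, sum_filter, sum_filter, mul_sum,
    ← sum_sub_distrib, ← sum_neg_distrib]
  refine sum_congr rfl fun G _ => ?_
  have h1 : (⟨n, G⟩ : Σ n, LDigraph n) ∈ stronglyConnected ↔ Strong univ G.edges :=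
    G.isStronglyConnected_iff
  by_cases hS : Strong univ G.edges
  · rw [weight, hS.comps_eq, prod_singleton]
    simp only [h1, hS, if_true, G.belongs_univ_iff, G.numEdges_eq]
    split_ifs <;> ring
  · have h2 : (⟨n, G⟩ : Σ n, LDigraph n) ∉ B := fun h => hS (h1.1 (hB h))
    simp [h1, hS, h2]

theorem countSeq_edgeless (n : ℕ) : countSeq edgeless (fun _ _ => 0) n = 1 := by
  rw [countSeq, sum_filter]
  have h : ∀ G : LDigraph n, (⟨n, G⟩ : Σ n, LDigraph n) ∈ edgeless ↔ G.edges = ∅ := fun G => by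
    rw [eq_empty_iff_forall_notMem, Prod.forall]
    simp only [LDigraph.mem_edges]
    rfl
  simp only [h, LDigraph.numEdges_eq, pow_zero, mul_one]
  rw [sum_edges fun E => if E = ∅ then w ^ E.card else 0]
  simp

theorem sumAll_empty {α R : Type*} [LinearOrder α] [CommRing R] (x y : R) (B : Family) :
    sumAll x y B (∅ : Finset α) = 1 := by
  simp [sumAll, weight, comps]

theorem sumBalanced_empty {α R : Type*} [LinearOrder α] [CommRing R] (x y : R) (B : Family) :
    sumBalanced x y B (∅ : Finset α) = 1 := by
  simp [sumBalanced, weight, comps, Balanced]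

theorem sumStrong_empty {α R : Type*} [LinearOrder α] [CommRing R] (x y : R) (B : Family) :
    sumStrong x y B (∅ : Finset α) = 0 := by
  simp [sumStrong, Strong]

/-- The vertex 0 is distinguished; `k` counts the other vertices of its component, whence `k + 1`.
-/
theorem sumBalanced_succ {R : Type*} [CommRing R] (x y : R) (B : Family) (n : ℕ) :
    sumBalanced x y B (univ : Finset (Fin (n + 1))) =
      -∑ k ∈ range (n + 1), n.choose k •
        (sumStrong x y B (univ : Finset (Fin (k + 1))) *
          sumBalanced x y B (univ : Finset (Fin (n - k)))) := by
  have h0 : (0 : Fin (n + 1)) ∉ univ.erase (0 : Fin (n + 1)) := by simp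
  have hcard : (univ.erase (0 : Fin (n + 1))).card = n := by simp
  rw [← insert_erase (mem_univ (0 : Fin (n + 1))), sumBalanced_insert x y B h0]
  have key := sum_powerset_apply_card (fun k => sumStrong x y B (univ : Finset (Fin (k + 1))) *
    sumBalanced x y B (univ : Finset (Fin (n - k)))) (x := univ.erase (0 : Fin (n + 1)))
  rw [hcard] at key
  rw [← key]
  congr 1
  refine sum_congr rfl fun C hC => ?_
  have hC := mem_powerset.1 hC
  rw [sumStrong_eq x y B (insert 0 C), sumBalanced_eq x y B (_ \ C),
    card_insert_of_notMem fun h => h0 (hC h), card_sdiff_of_subset hC, hcard]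

theorem sum_choose_sumBalanced_mul_sumAll {R : Type*} [CommRing R] (x y : R) (B : Family) {n : ℕ}
    (hn : 0 < n) :
    ∑ k ∈ range (n + 1), n.choose k • (sumBalanced x y B (univ : Finset (Fin k)) *
      ((1 + x) ^ (k * (n - k)) * sumAll x y B (univ : Finset (Fin (n - k))))) = 0 := by
  have key := sum_powerset_apply_card (fun k => sumBalanced x y B (univ : Finset (Fin k)) *
      ((1 + x) ^ (k * (n - k)) * sumAll x y B (univ : Finset (Fin (n - k)))))
      (x := (univ : Finset (Fin n)))
  rw [card_univ, Fintype.card_fin] at key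
  have : Nonempty (Fin n) := ⟨⟨0, hn⟩⟩
  rw [← key, ← sum_sumBalanced_mul_sumAll x y B (univ_nonempty (α := Fin n))]
  refine sum_congr rfl fun U hU => ?_
  rw [sumBalanced_eq x y B U, sumAll_eq x y B (univ \ U), card_sdiff_of_subset (subset_univ U),
    card_univ, Fintype.card_fin]

end Digraphs

/-! ### Exponential and graphic generating functions -/

section Series

open Finset

/-- The exponential formula, as a recurrence that splits off one factor. -/
theorem coeff_expOf_egf {f c : ℕ → Coeff} (hf : f 0 = 0) (hc : c 0 = 1)
    (hrec : ∀ n, c (n + 1) = ∑ k ∈ range (n + 1), n.choose k • (f (k + 1) * c (n - k))) (n : ℕ) :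
    PowerSeries.coeff n (expOf (egf f)) = (1 / (n ! : ℚ)) • c n := by
  have hconst : PowerSeries.constantCoeff (egf f) = 0 := by
    rw [← PowerSeries.coeff_zero_eq_constantCoeff_apply]
    simp [egf, hf]
  have hs : PowerSeries.HasSubst (egf f) := PowerSeries.HasSubst.of_constantCoeff_zero' hconst
  -- The exponential series is moved to coefficients in `Coeff`, the ring over which the derivation
  -- below is taken.
  have hexp : expOf (egf f) = (PowerSeries.exp Coeff).subst (egf f) := by
    rw [expOf]
    ext1 m
    rw [PowerSeries.coeff_subst' hs, PowerSeries.coeff_subst' hs]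
    refine finsum_congr fun d => ?_
    rw [PowerSeries.coeff_exp, PowerSeries.coeff_exp, smul_eq_mul, Algebra.smul_def]
    rfl
  have hder : PowerSeries.derivative Coeff (expOf (egf f)) =
      expOf (egf f) * PowerSeries.derivative Coeff (egf f) := by
    rw [hexp, PowerSeries.derivative_subst hs, PowerSeries.derivative_exp]
  have hcast : ∀ (a : Coeff) (m : ℕ), a * ((m : Coeff) + 1) = ((m : ℚ) + 1) • a := fun a m => by
    rw [add_smul, one_smul, mul_add, mul_one, Nat.cast_smul_eq_nsmul, nsmul_eq_mul, mul_comm]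
  induction n using Nat.strong_induction_on with
  | _ n ih =>
    cases n with
    | zero =>
      rw [hexp, PowerSeries.coeff_zero_eq_constantCoeff_apply, PowerSeries.constantCoeff,
        PowerSeries.constantCoeff_subst hs]
      rw [finsum_eq_single _ 0]
      · simp [hc]
      · intro d hd
        rw [map_pow]
        have : MvPowerSeries.constantCoeff (egf f) = 0 := hconst
        rw [this, zero_pow hd, smul_zero]
    | succ n =>
      have h := congrArg (PowerSeries.coeff n) hder
      rw [PowerSeries.coeff_derivative, hcast, mul_comm (expOf _), PowerSeries.coeff_mul,
        Nat.sum_antidiagonal_eq_sum_range_succ fun i j =>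
          PowerSeries.coeff i (PowerSeries.derivative Coeff (egf f)) *
            PowerSeries.coeff j (expOf (egf f))] at h
      have hn : ((n : ℚ) + 1) ≠ 0 := by positivity
      rw [← inv_smul_smul₀ hn (PowerSeries.coeff (n + 1) (expOf (egf f))), h, hrec, smul_sum,
        smul_sum]
      refine sum_congr rfl fun k hk => ?_
      have hk : k ≤ n := Nat.lt_succ_iff.1 (mem_range.1 hk)
      rw [ih (n - k) (by omega), PowerSeries.coeff_derivative, hcast, egf, PowerSeries.coeff_mk,
        ← Nat.cast_smul_eq_nsmul ℚ]
      simp only [smul_mul_assoc, mul_smul_comm, smul_smul]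
      congr 1
      rw [Nat.cast_choose ℚ hk, Nat.factorial_succ, Nat.factorial_succ]
      push_cast
      field_simp

theorem add_choose_two (i j : ℕ) : (i + j).choose 2 = i.choose 2 + j.choose 2 + i * j := by
  induction j with
  | zero => simp
  | succ j ih =>
    rw [← add_assoc, Nat.choose_succ_succ' (i + j) 1, ih, Nat.choose_succ_succ' j 1]
    simp only [Nat.choose_one_right]
    ring

theorem inverse_pow_mul_inverse_pow {R : Type*} [CommRing R] {x : R} (hx : IsUnit x) (i j e : ℕ) :
    Ring.inverse (x ^ i) * Ring.inverse (x ^ j) = x ^ e * Ring.inverse (x ^ (i + j + e)) := by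
  have h1 := Ring.mul_inverse_cancel _ (hx.pow i)
  have h2 := Ring.mul_inverse_cancel _ (hx.pow j)
  have h3 := Ring.mul_inverse_cancel _ (hx.pow (i + j + e))
  rw [pow_add, pow_add] at h3 ⊢
  generalize Ring.inverse (x ^ i) = r at *
  generalize Ring.inverse (x ^ j) = s at *
  generalize Ring.inverse (x ^ i * x ^ j * x ^ e) = t at *
  calc r * s = r * s * (x ^ i * x ^ j * x ^ e * t) := by rw [h3, mul_one]
    _ = (x ^ i * r) * (x ^ j * s) * (x ^ e * t) := by ring
    _ = x ^ e * t := by rw [h1, h2, one_mul, one_mul]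

theorem smul_inverse_mul_smul_inverse {R : Type*} [CommRing R] [Algebra ℚ R] {x : R}
    (hx : IsUnit x) (a b : R) {k n : ℕ} (hk : k ≤ n) :
    ((1 / (k ! : ℚ)) • (a * Ring.inverse (x ^ k.choose 2))) *
      ((1 / ((n - k)! : ℚ)) • (b * Ring.inverse (x ^ (n - k).choose 2))) =
    (1 / (n ! : ℚ)) • (n.choose k • (a * (x ^ (k * (n - k)) * b)) *
      Ring.inverse (x ^ n.choose 2)) := by
  have hch : n.choose 2 = k.choose 2 + (n - k).choose 2 + k * (n - k) := by
    rw [← add_choose_two, Nat.add_sub_cancel' hk]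
  have hpow := inverse_pow_mul_inverse_pow hx (k.choose 2) ((n - k).choose 2) (k * (n - k))
  rw [← hch] at hpow
  rw [← Nat.cast_smul_eq_nsmul ℚ]
  simp only [smul_mul_assoc, mul_smul_comm, smul_smul]
  congr 1
  · rw [Nat.cast_choose ℚ hk]
    field_simp
  · linear_combination a * b * hpow

/-- The graphic product of sequences corresponds to the product of graphic generating functions. -/
theorem ggf_mul_ggf (a b : ℕ → Coeff) :
    ggf a * ggf b = ggf fun n => ∑ k ∈ range (n + 1),
      n.choose k • (a k * ((1 + w) ^ (k * (n - k)) * b (n - k))) := by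
  ext1 n
  rw [PowerSeries.coeff_mul, Nat.sum_antidiagonal_eq_sum_range_succ fun i j =>
    PowerSeries.coeff i (ggf a) * PowerSeries.coeff j (ggf b)]
  simp only [ggf, PowerSeries.coeff_mk, sum_mul, smul_sum]
  exact sum_congr rfl fun k hk => smul_inverse_mul_smul_inverse isUnit_one_add_w _ _
    (Nat.lt_succ_iff.1 (mem_range.1 hk))

/-- There is one edgeless digraph of each order, so this Hadamard product just divides by `(1 + w) ^
n.choose 2`. -/
theorem expHadamard_edgeless {F : PowerSeries Coeff} {c : ℕ → Coeff}
    (h : ∀ n, PowerSeries.coeff n F = (1 / (n ! : ℚ)) • c n) :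
    expHadamard (familyGGF edgeless) F = ggf c := by
  ext1 n
  have hn : (n ! : ℚ) ≠ 0 := by positivity
  simp only [expHadamard, familyGGF, ggf, PowerSeries.coeff_mk, h, countSeq_edgeless, smul_smul,
    one_mul, mul_one_div_cancel hn, one_smul, mul_comm (c n)]

end Series

end DigraphGF

end

/-- The exponent has no constant term in `z`, the displayed denominator is invertible, and its
inverse is the GGF of all digraphs in which `u` marks the strongly connected components
from `B`. -/
theorem corollary3p6 (B : DigraphGF.Family) (hne : B.Nonempty)
    (hB : B ⊆ DigraphGF.stronglyConnected) :
    PowerSeries.constantCoeff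
        (PowerSeries.C (1 - DigraphGF.u) * DigraphGF.familyEGF B -
          DigraphGF.familyEGF DigraphGF.stronglyConnected) = 0 ∧
    IsUnit (DigraphGF.expHadamard (DigraphGF.familyGGF DigraphGF.edgeless)
        (DigraphGF.expOf (PowerSeries.C (1 - DigraphGF.u) * DigraphGF.familyEGF B -
          DigraphGF.familyEGF DigraphGF.stronglyConnected))) ∧
    DigraphGF.markedGGF DigraphGF.allDigraphs (fun _ G => DigraphGF.numComponentsIn B G) =
      Ring.inverse (DigraphGF.expHadamard (DigraphGF.familyGGF DigraphGF.edgeless)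
        (DigraphGF.expOf (PowerSeries.C (1 - DigraphGF.u) * DigraphGF.familyEGF B -
          DigraphGF.familyEGF DigraphGF.stronglyConnected))) := by
  have hF : PowerSeries.C (1 - DigraphGF.u) * DigraphGF.familyEGF B - DigraphGF.familyEGF DigraphGF.stronglyConnected =
      DigraphGF.egf fun n => -DigraphGF.sumStrong DigraphGF.w DigraphGF.u B (Finset.univ : Finset (Fin n)) := by
    ext1 n
    rw [map_sub, PowerSeries.coeff_C_mul]
    simp only [DigraphGF.familyEGF, DigraphGF.egf, PowerSeries.coeff_mk,
      ← DigraphGF.countSeq_strong B hB, smul_sub, mul_smul_comm]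
  have hM : DigraphGF.expHadamard (DigraphGF.familyGGF DigraphGF.edgeless)
      (DigraphGF.expOf (DigraphGF.egf fun n => -DigraphGF.sumStrong DigraphGF.w DigraphGF.u B (Finset.univ : Finset (Fin n)))) =
      DigraphGF.ggf fun n => DigraphGF.sumBalanced DigraphGF.w DigraphGF.u B (Finset.univ : Finset (Fin n)) := by
    refine DigraphGF.expHadamard_edgeless (DigraphGF.coeff_expOf_egf ?_ ?_ fun n => ?_)
    · simp [DigraphGF.sumStrong_empty]
    · simp [DigraphGF.sumBalanced_empty]
    · rw [DigraphGF.sumBalanced_succ, ← Finset.sum_neg_distrib]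
      exact Finset.sum_congr rfl fun k _ => by rw [neg_mul, smul_neg]
  -- Only the empty vertex set escapes the cancellation, leaving the constant term 1.
  have hprod : (DigraphGF.ggf fun n => DigraphGF.sumBalanced DigraphGF.w DigraphGF.u B (Finset.univ : Finset (Fin n))) *
      DigraphGF.markedGGF DigraphGF.allDigraphs (fun _ G => DigraphGF.numComponentsIn B G) = 1 := by
    rw [DigraphGF.markedGGF, DigraphGF.ggf_mul_ggf]
    ext1 n
    rw [DigraphGF.ggf, PowerSeries.coeff_mk, PowerSeries.coeff_one]
    simp only [DigraphGF.countSeq_allDigraphs]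
    rcases Nat.eq_zero_or_pos n with rfl | hn
    · simp [DigraphGF.sumBalanced_empty, DigraphGF.sumAll_empty]
    · rw [DigraphGF.sum_choose_sumBalanced_mul_sumAll DigraphGF.w DigraphGF.u B hn, zero_mul, smul_zero, if_neg hn.ne']
  have hunit := IsUnit.of_mul_eq_one _ hprod
  rw [hF, hM]
  refine ⟨?_, hunit, ?_⟩
  · rw [← PowerSeries.coeff_zero_eq_constantCoeff_apply]
    simp [DigraphGF.egf, DigraphGF.sumStrong_empty]
  · rw [← mul_one (Ring.inverse _)]
    exact ((Ring.inverse_mul_eq_iff_eq_mul _ _ _ hunit).2 hprod.symm).symm
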